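/- **Theorem.** Let $L$ be a finite modular lattice that is not distributive, let $K$ be a field, and let $K[L]$ be the polynomial ring over $K$ whose variables are the elements of $L$. Let $$I_L=\bigl(ab-(a\wedge b)(a\vee b)\;:\; a,b\in L,\ a,b \text{ incomparable}\bigr)\subset K[L]$$ be the join-meet ideal of $L$. Then, for every monomial order $<$ on $K[L]$, the initial ideal $\operatorname{in}_<(I_L)$, that is, the ideal generated by the initial monomials $\operatorname{in}_<(f)$ of all nonzero $f\in I_L$, is not squarefree: it cannot be generated by squarefree monomials (monomials in which every variable has exponent at most $1$). -/

import Mathlib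

/-- A lattice is distributive if meets distribute over joins. -/
def IsDistributiveLattice (L : Type*) [Lattice L] : Prop :=
  ∀ x y z : L, x ⊓ (y ⊔ z) = (x ⊓ y) ⊔ (x ⊓ z)

/-- The join-meet ideal of a lattice `L` in the polynomial ring `K[L]` whose variables are the
elements of `L`: it is generated by the basic binomials `ab - (a ∧ b)(a ∨ b)` with `a`, `b`
incomparable. -/
noncomputable def joinMeetIdeal (K : Type*) [CommRing K] (L : Type*) [Lattice L] :
    Ideal (MvPolynomial L K) :=
  Ideal.span {f | ∃ a b : L, ¬ a ≤ b ∧ ¬ b ≤ a ∧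
    f = MvPolynomial.X a * MvPolynomial.X b -
      MvPolynomial.X (a ⊓ b) * MvPolynomial.X (a ⊔ b)}

/-- The initial ideal of `I` with respect to the monomial order `m`: it is generated by the initial
monomials of the nonzero elements of `I`. -/
noncomputable def initialIdeal {σ : Type*} {K : Type*} [Field K] (m : MonomialOrder σ)
    (I : Ideal (MvPolynomial σ K)) : Ideal (MvPolynomial σ K) :=
  Ideal.span {p | ∃ f ∈ I, f ≠ 0 ∧ p = MvPolynomial.monomial (m.degree f) 1}

/-- A monomial ideal is squarefree if it is generated by squarefree monomials, that is, by monomials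
in which every variable has exponent at most one. -/
def IsSquarefreeMonomialIdeal {σ : Type*} {K : Type*} [Field K]
    (J : Ideal (MvPolynomial σ K)) : Prop :=
  ∃ S : Set (σ →₀ ℕ), (∀ s ∈ S, ∀ i, s i ≤ 1) ∧
    J = Ideal.span ((fun s => MvPolynomial.monomial s (1 : K)) '' S)

/-!
A modular lattice that is not distributive contains a diamond (`exists_isDiamond`), and finiteness
and perspectivity shrink it to one inside an interval `[p, q]` of length two
(`exists_interval_three_complements`). Any two distinct elements strictly inside this interval are
complements in it, and there are at least three of them.

The join-meet ideal `I` is spanned by differences of monomials, so it determines a congruence on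
monomials, and the sum of the coefficients of an element of `I` over any union of congruence classes
vanishes (`coeffSum_eq_zero_of_mem`). Hence a monomial that is the smallest in a union of classes is
not an initial monomial of `I` (`monomial_notMem_initialIdeal_of_isLeast`). Two such unions, those
of `pq` and of the `pqz` with `p < z < q`, are described by the support, the degree and the total
rank (`rankClass`): the first consists of `pq` and the products of two distinct elements strictly
inside the interval, the second of these multiplied by one more such element.

Suppose that the initial ideal is squarefree; then with a monomial it contains the product of the
variables of that monomial. Let `u` be the smallest monomial of the class of `pq`.

* If `u = xy` with `x`, `y` strictly inside the interval, a third element `z` gives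
  `x²y - xy² ∈ I`. One of the two terms is initial, hence `xy` is, a contradiction.
* If `u = pq`, then some `pqz` is the smallest monomial of the second union. Two more elements
  strictly inside the interval give `z²pq - p²q² ∈ I`. One of the two terms is initial, hence
  `pqz` or `pq` is, a contradiction.
-/

open MvPolynomial

/-! ### Diamonds in modular lattices -/

/-- The elements `a`, `b`, `c` span a diamond with bottom `p` and top `q`: any two of them are
complements of each other in the interval `[p, q]`, and this interval is nontrivial. -/
structure IsDiamond {L : Type*} [Lattice L] (p q a b c : L) : Prop where
  ne : p ≠ q
  inf_ab : a ⊓ b = p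
  inf_ac : a ⊓ c = p
  inf_bc : b ⊓ c = p
  sup_ab : a ⊔ b = q
  sup_ac : a ⊔ c = q
  sup_bc : b ⊔ c = q

/-- The elements `(x ⊓ (y ⊔ z)) ⊔ (y ⊓ z)` and `(y ⊓ (x ⊔ z)) ⊔ (x ⊓ z)`, which belong to Dedekind's
diamond generated by `x`, `y`, `z`, meet in the lower median. -/
lemma inf_median_eq {L : Type*} [Lattice L] [IsModularLattice L] (x y z : L) :
    (x ⊓ (y ⊔ z) ⊔ y ⊓ z) ⊓ (y ⊓ (x ⊔ z) ⊔ x ⊓ z) = x ⊓ y ⊔ x ⊓ z ⊔ y ⊓ z := by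
  apply le_antisymm
  · have h1 : y ⊓ (x ⊔ z) ⊔ x ⊓ z = (x ⊔ z) ⊓ (y ⊔ x ⊓ z) := by
      rw [inf_comm, inf_sup_assoc_of_le y (inf_le_left.trans le_sup_left : x ⊓ z ≤ x ⊔ z)]
    have h2 : y ⊓ z ≤ y ⊓ (x ⊔ z) ⊔ x ⊓ z :=
      (inf_le_inf_left y le_sup_right).trans le_sup_left
    have h3 : x ⊓ (y ⊔ x ⊓ z) ≤ x ⊓ y ⊔ x ⊓ z := by
      rw [← inf_sup_assoc_of_le y (inf_le_left : x ⊓ z ≤ x)]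
    rw [sup_comm (x ⊓ (y ⊔ z)), sup_inf_assoc_of_le _ h2, h1, sup_comm (y ⊓ z)]
    refine sup_le_sup_right (le_trans ?_ h3) _
    exact le_inf (inf_le_left.trans inf_le_left) (inf_le_right.trans inf_le_right)
  · refine le_inf (sup_le (sup_le ?_ ?_) ?_) (sup_le (sup_le ?_ ?_) ?_)
    · exact (inf_le_inf_left x le_sup_left).trans le_sup_left
    · exact (inf_le_inf_left x le_sup_right).trans le_sup_left
    · exact le_sup_right
    · exact (le_inf inf_le_right (inf_le_left.trans le_sup_left)).trans le_sup_left
    · exact le_sup_right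
    · exact (inf_le_inf_left y le_sup_right).trans le_sup_left

/-- The self-dual description of the elements of Dedekind's diamond. -/
lemma median_element_eq {L : Type*} [Lattice L] [IsModularLattice L] (x y z : L) :
    x ⊓ (y ⊔ z) ⊔ y ⊓ z = (x ⊔ y ⊓ z) ⊓ (y ⊔ z) := by
  rw [inf_comm, inf_sup_assoc_of_le x (inf_le_left.trans le_sup_left : y ⊓ z ≤ y ⊔ z), inf_comm]

/-- The dual of `inf_median_eq`. -/
lemma sup_median_eq {L : Type*} [Lattice L] [IsModularLattice L] (x y z : L) :
    (x ⊓ (y ⊔ z) ⊔ y ⊓ z) ⊔ (y ⊓ (x ⊔ z) ⊔ x ⊓ z) = (x ⊔ y) ⊓ (x ⊔ z) ⊓ (y ⊔ z) := by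
  rw [median_element_eq, median_element_eq]
  have h := inf_median_eq (L := Lᵒᵈ) (OrderDual.toDual x) (OrderDual.toDual y) (OrderDual.toDual z)
  rw [median_element_eq, median_element_eq] at h
  have h' := congrArg OrderDual.ofDual h
  simp only [ofDual_inf, ofDual_sup, OrderDual.ofDual_toDual] at h'
  rw [← h', median_element_eq, median_element_eq]

/-- Dedekind: a modular lattice that is not distributive contains a diamond. -/
lemma exists_isDiamond {L : Type*} [Lattice L] [IsModularLattice L]
    (hL : ¬ IsDistributiveLattice L) : ∃ p q a b c : L, IsDiamond p q a b c := by
  simp only [IsDistributiveLattice, not_forall] at hL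
  obtain ⟨x, y, z, h⟩ := hL
  refine ⟨x ⊓ y ⊔ x ⊓ z ⊔ y ⊓ z, (x ⊔ y) ⊓ (x ⊔ z) ⊓ (y ⊔ z), x ⊓ (y ⊔ z) ⊔ y ⊓ z,
    y ⊓ (x ⊔ z) ⊔ x ⊓ z, z ⊓ (x ⊔ y) ⊔ x ⊓ y, ?_, inf_median_eq x y z, ?_, ?_,
    sup_median_eq x y z, ?_, ?_⟩
  · -- The meets of `x` with the two medians are the two sides of the distributive law.
    intro e
    apply h
    have e' := congrArg (x ⊓ ·) e
    have h1 : x ⊓ (x ⊓ y ⊔ x ⊓ z ⊔ y ⊓ z) = x ⊓ y ⊔ x ⊓ z := by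
      rw [inf_comm, sup_inf_assoc_of_le _ (sup_le inf_le_left inf_le_left : x ⊓ y ⊔ x ⊓ z ≤ x)]
      exact sup_eq_left.2 ((le_inf inf_le_right (inf_le_left.trans inf_le_left)).trans le_sup_left)
    have h2 : x ⊓ ((x ⊔ y) ⊓ (x ⊔ z) ⊓ (y ⊔ z)) = x ⊓ (y ⊔ z) := by
      rw [← inf_assoc, inf_eq_left.2 (le_inf le_sup_left le_sup_left : x ≤ (x ⊔ y) ⊓ (x ⊔ z))]
    simp only [h1, h2] at e'
    exact e'.symm
  · have := inf_median_eq x z y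
    rw [sup_comm z y, inf_comm z y] at this
    rw [this]; ac_rfl
  · have := inf_median_eq y z x
    rw [sup_comm z x, inf_comm z x, sup_comm y x, inf_comm y x] at this
    rw [this]; ac_rfl
  · have := sup_median_eq x z y
    rw [sup_comm z y, inf_comm z y] at this
    rw [this]; ac_rfl
  · have := sup_median_eq y z x
    rw [sup_comm z x, inf_comm z x, sup_comm y x, inf_comm y x] at this
    rw [this]; ac_rfl

/-- A diamond can be shrunk to one in which `a` is an atom of the interval: replace `a` by an
atom `a' ≤ a` of the interval, and `b`, `c` by the images of `a'` under perspectivities. -/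
lemma IsDiamond.exists_covBy {L : Type*} [Lattice L] [IsModularLattice L] [Finite L]
    {p q a b c : L} (h : IsDiamond p q a b c) :
    ∃ q' a' b' c' : L, IsDiamond p q' a' b' c' ∧ p ⋖ a' := by
  have hpa : p < a := by
    refine lt_of_le_of_ne (h.inf_ab ▸ inf_le_left) fun e => h.ne ?_
    have hb : b = q := by
      rw [← h.sup_ab, ← e]; exact (sup_eq_right.2 (h.inf_ab ▸ inf_le_right)).symm
    have hc : c = q := by
      rw [← h.sup_ac, ← e]; exact (sup_eq_right.2 (h.inf_ac ▸ inf_le_right)).symm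
    rw [← h.inf_bc, hb, hc, inf_idem]
  obtain ⟨a', hpa', ha'⟩ := exists_covBy_le_of_lt hpa
  have hpb : p ≤ b := h.inf_ab ▸ inf_le_right
  have hpc : p ≤ c := h.inf_ac ▸ inf_le_right
  have hbc : b ⊓ (a' ⊔ c) ⊔ c = a' ⊔ c := by
    rw [inf_comm, inf_sup_assoc_of_le b (le_sup_right : c ≤ a' ⊔ c), h.sup_bc,
      inf_eq_left.2]
    exact sup_le (ha'.trans (h.sup_ac ▸ le_sup_left)) (h.sup_ac ▸ le_sup_right)
  have hle : a' ⊔ b ⊓ (a' ⊔ c) ≤ a' ⊔ c := sup_le le_sup_left inf_le_right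
  have hac : a' ⊔ c ⊓ (a' ⊔ b ⊓ (a' ⊔ c)) = a' ⊔ b ⊓ (a' ⊔ c) := by
    rw [← sup_inf_assoc_of_le c (le_sup_left : a' ≤ a' ⊔ b ⊓ (a' ⊔ c)), inf_eq_right.2 hle]
  have hbc' : b ⊓ (a' ⊔ c) ⊔ c ⊓ (a' ⊔ b ⊓ (a' ⊔ c)) = a' ⊔ b ⊓ (a' ⊔ c) := by
    rw [← sup_inf_assoc_of_le c (le_sup_right : b ⊓ (a' ⊔ c) ≤ a' ⊔ b ⊓ (a' ⊔ c)), hbc,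
      inf_eq_right.2 hle]
  have hpb' : p ≤ b ⊓ (a' ⊔ c) := le_inf hpb (hpc.trans le_sup_right)
  refine ⟨a' ⊔ b ⊓ (a' ⊔ c), a', b ⊓ (a' ⊔ c), c ⊓ (a' ⊔ b ⊓ (a' ⊔ c)),
    ⟨(hpa'.lt.trans_le le_sup_left).ne, ?_, ?_, ?_, rfl, hac, hbc'⟩, hpa'⟩
  · exact le_antisymm (h.inf_ab ▸ inf_le_inf ha' inf_le_left) (le_inf hpa'.le hpb')
  · exact le_antisymm (h.inf_ac ▸ inf_le_inf ha' inf_le_left)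
      (le_inf hpa'.le (le_inf hpc (hpa'.le.trans le_sup_left)))
  · exact le_antisymm (h.inf_bc ▸ inf_le_inf inf_le_left inf_le_left)
      (le_inf hpb' (le_inf hpc (hpa'.le.trans le_sup_left)))

/-- In a modular lattice, any two distinct elements strictly inside an interval of length two
are complements of each other in it. -/
lemma inf_eq_and_sup_eq_of_covBy {L : Type*} [Lattice L] [IsModularLattice L] {p q a x y : L}
    (hpa : p ⋖ a) (haq : a ⋖ q) (hx : x ∈ Set.Ioo p q) (hy : y ∈ Set.Ioo p q) (hxy : x ≠ y) :
    x ⊓ y = p ∧ x ⊔ y = q := by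
  -- Every element strictly inside the interval covers `p` and is covered by `q`, like `a`.
  have key : ∀ z ∈ Set.Ioo p q, p ⋖ z ∧ z ⋖ q := by
    intro z hz
    by_cases e : z = a
    · exact e ▸ ⟨hpa, haq⟩
    have hi : a ⊓ z = p := by
      rcases hpa.eq_or_eq (le_inf hpa.le hz.1.le) inf_le_left with h | h
      · exact h
      · rcases haq.eq_or_eq (inf_eq_left.1 h) hz.2.le with h' | h'
        · exact absurd h' e
        · exact absurd h' hz.2.ne
    have hs : a ⊔ z = q := by
      rcases haq.eq_or_eq le_sup_left (sup_le haq.le hz.2.le) with h | h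
      · rcases hpa.eq_or_eq hz.1.le (sup_eq_left.1 h) with h' | h'
        · exact absurd h' hz.1.ne'
        · exact absurd h' e
      · exact h
    refine ⟨?_, ?_⟩
    · rw [← hi]; exact inf_covBy_of_covBy_sup_left (hs.symm ▸ haq)
    · rw [← hs]; exact covBy_sup_of_inf_covBy_left (hi.symm ▸ hpa)
  constructor
  · rcases (key x hx).1.eq_or_eq (le_inf hx.1.le hy.1.le) inf_le_left with h | h
    · exact h
    · rcases (key y hy).1.eq_or_eq hx.1.le (inf_eq_left.1 h) with h' | h'
      · exact absurd h' hx.1.ne'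
      · exact absurd h' hxy
  · rcases (key x hx).2.eq_or_eq le_sup_left (sup_le hx.2.le hy.2.le) with h | h
    · rcases (key y hy).2.eq_or_eq (sup_eq_left.1 h) hx.2.le with h' | h'
      · exact absurd h' hxy
      · exact absurd h' hx.2.ne
    · exact h

/-- A finite modular lattice that is not distributive has an interval of length two with at least
three elements strictly inside. -/
lemma exists_interval_three_complements {L : Type*} [Lattice L] [IsModularLattice L] [Finite L]
    (hL : ¬ IsDistributiveLattice L) :
    ∃ p q : L, (∀ x ∈ Set.Ioo p q, ∀ y ∈ Set.Ioo p q, x ≠ y → x ⊓ y = p ∧ x ⊔ y = q) ∧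
      ∃ a ∈ Set.Ioo p q, ∃ b ∈ Set.Ioo p q, ∃ c ∈ Set.Ioo p q, a ≠ b ∧ a ≠ c ∧ b ≠ c := by
  obtain ⟨p, q₀, a₀, b₀, c₀, h₀⟩ := exists_isDiamond hL
  obtain ⟨q, a, b, c, h, hpa⟩ := h₀.exists_covBy
  -- The covering `p ⋖ a` propagates along perspectivities.
  have hbq : b ⋖ q := by
    rw [← h.sup_ab]; exact covBy_sup_of_inf_covBy_left (h.inf_ab.symm ▸ hpa)
  have hcq : c ⋖ q := by
    rw [← h.sup_ac]; exact covBy_sup_of_inf_covBy_left (h.inf_ac.symm ▸ hpa)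
  have hpb : p ⋖ b := by
    rw [← h.inf_bc]; exact inf_covBy_of_covBy_sup_right (h.sup_bc.symm ▸ hcq)
  have hpc : p ⋖ c := by
    rw [← h.inf_bc]; exact inf_covBy_of_covBy_sup_left (h.sup_bc.symm ▸ hbq)
  have haq : a ⋖ q := by
    rw [← h.sup_ab]; exact covBy_sup_of_inf_covBy_right (h.inf_ab.symm ▸ hpb)
  refine ⟨p, q, fun x hx y hy hxy => inf_eq_and_sup_eq_of_covBy hpa haq hx hy hxy,
    a, ⟨hpa.lt, haq.lt⟩, b, ⟨hpb.lt, hbq.lt⟩, c, ⟨hpc.lt, hcq.lt⟩, ?_, ?_, ?_⟩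
  · rintro rfl; exact h.ne (by rw [← h.inf_ab, ← h.sup_ab, inf_idem, sup_idem])
  · rintro rfl; exact h.ne (by rw [← h.inf_ac, ← h.sup_ac, inf_idem, sup_idem])
  · rintro rfl; exact h.ne (by rw [← h.inf_bc, ← h.sup_bc, inf_idem, sup_idem])

/-! ### Initial ideals -/

lemma monomial_mem_initialIdeal_iff {σ K : Type*} [Field K] (m : MonomialOrder σ)
    (I : Ideal (MvPolynomial σ K)) (u : σ →₀ ℕ) :
    monomial u (1 : K) ∈ initialIdeal m I ↔ ∃ f ∈ I, f ≠ 0 ∧ m.degree f = u := by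
  classical
  constructor
  · intro h
    have hset : {g : MvPolynomial σ K | ∃ f ∈ I, f ≠ 0 ∧ g = monomial (m.degree f) 1} =
        (fun s => monomial s (1 : K)) '' {d | ∃ f ∈ I, f ≠ 0 ∧ m.degree f = d} := by
      ext g
      constructor
      · rintro ⟨f, hf, hf0, rfl⟩
        exact ⟨_, ⟨f, hf, hf0, rfl⟩, rfl⟩
      · rintro ⟨_, ⟨f, hf, hf0, rfl⟩, rfl⟩
        exact ⟨f, hf, hf0, rfl⟩
    rw [initialIdeal, hset, mem_ideal_span_monomial_image] at h
    obtain ⟨_, ⟨f, hf, hf0, rfl⟩, hle⟩ := h u (by simp [mem_support_iff])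
    have h1 : monomial (u - m.degree f) (1 : K) ≠ 0 := by simp
    refine ⟨monomial (u - m.degree f) 1 * f, I.mul_mem_left _ hf, mul_ne_zero h1 hf0, ?_⟩
    rw [m.degree_mul h1 hf0, m.degree_monomial, if_neg one_ne_zero, tsub_add_cancel_of_le hle]
  · rintro ⟨f, hf, hf0, rfl⟩
    exact Ideal.subset_span ⟨f, hf, hf0, rfl⟩

lemma monomial_mem_initialIdeal_of_sub_mem {σ K : Type*} [Field K] {m : MonomialOrder σ}
    {I : Ideal (MvPolynomial σ K)} {u v : σ →₀ ℕ} (hvu : m.toSyn v < m.toSyn u)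
    (h : monomial u (1 : K) - monomial v 1 ∈ I) : monomial u (1 : K) ∈ initialIdeal m I := by
  classical
  rw [monomial_mem_initialIdeal_iff]
  have hd : ∀ w : σ →₀ ℕ, m.degree (monomial w (1 : K)) = w := fun w => by
    rw [m.degree_monomial, if_neg one_ne_zero]
  refine ⟨_, h, ?_, ?_⟩
  · rw [sub_ne_zero]
    intro e
    have := congrArg m.degree e
    rw [hd, hd] at this
    exact hvu.ne (this ▸ rfl)
  · rw [m.degree_sub_of_lt (by rwa [hd, hd]), hd]

/-- A squarefree monomial ideal that contains a monomial contains every monomial with at least the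
same variables. -/
lemma IsSquarefreeMonomialIdeal.monomial_mem {σ K : Type*} [Field K]
    {J : Ideal (MvPolynomial σ K)} (hJ : IsSquarefreeMonomialIdeal J) {u v : σ →₀ ℕ}
    (hu : monomial u (1 : K) ∈ J) (huv : u.support ⊆ v.support) : monomial v (1 : K) ∈ J := by
  classical
  obtain ⟨S, hS, rfl⟩ := hJ
  rw [mem_ideal_span_monomial_image] at hu ⊢
  obtain ⟨s, hs, hsu⟩ := hu u (by simp [mem_support_iff])
  intro w hw
  obtain rfl : v = w := by
    by_contra hne
    simp [mem_support_iff, coeff_monomial, hne] at hw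
  refine ⟨s, hs, fun i => ?_⟩
  by_cases hi : s i = 0
  · simp [hi]
  · have h1 : i ∈ u.support := by
      rw [Finsupp.mem_support_iff]
      have := hsu i
      omega
    have h2 := Finsupp.mem_support_iff.1 (huv h1)
    have := hS s hs i
    omega

/-! ### Coefficient sums over classes of monomials -/

/-- A set of monomials is closed under straightening if it is a union of classes of the congruence
generated by `ab ~ (a ∧ b)(a ∨ b)` for incomparable `a` and `b`. -/
def IsStraighteningClosed {L : Type*} [Lattice L] (C : Set (L →₀ ℕ)) : Prop :=
  ∀ (a b : L) (w : L →₀ ℕ), ¬ a ≤ b → ¬ b ≤ a →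
    (w + (Finsupp.single a 1 + Finsupp.single b 1) ∈ C ↔
      w + (Finsupp.single (a ⊓ b) 1 + Finsupp.single (a ⊔ b) 1) ∈ C)

/-- The sum of the coefficients of a polynomial at the monomials in `C`. -/
noncomputable def coeffSum {σ : Type*} (K : Type*) [Field K] (C : Set (σ →₀ ℕ)) :
    MvPolynomial σ K →ₗ[K] K := by
  classical
  exact (basisMonomials σ K).constr K (fun s => if s ∈ C then 1 else 0)

open Classical in
lemma coeffSum_monomial {σ K : Type*} [Field K] (C : Set (σ →₀ ℕ)) (s : σ →₀ ℕ) (r : K) :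
    coeffSum K C (monomial s r) = if s ∈ C then r else 0 := by
  have h : monomial s r = r • basisMonomials σ K s := by
    simp [smul_monomial]
  rw [h, map_smul, coeffSum, Module.Basis.constr_basis]
  split_ifs <;> simp

lemma coeffSum_eq_zero_of_mem {L K : Type*} [Lattice L] [Field K] {C : Set (L →₀ ℕ)}
    (hC : IsStraighteningClosed C) {f : MvPolynomial L K} (hf : f ∈ joinMeetIdeal K L) :
    coeffSum K C f = 0 := by
  classical
  induction hf using Submodule.closure_induction with
  | zero => exact map_zero _
  | add x y _ _ hx hy => rw [map_add, hx, hy, add_zero]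
  | smul_mem g x hx =>
    obtain ⟨a, b, hab, hba, rfl⟩ := hx
    rw [smul_eq_mul]
    induction g using MvPolynomial.induction_on' with
    | add g g' hg hg' => rw [add_mul, map_add, hg, hg', add_zero]
    | monomial w r =>
      simp only [X, monomial_mul, mul_one, mul_sub, map_sub, coeffSum_monomial,
        hC a b w hab hba, sub_self]

/-- A monomial that is the smallest one of a set closed under straightening is not an initial
monomial: in a polynomial with this initial monomial, it would be the only monomial of the set,
so the sum of the coefficients over the set could not vanish. -/
lemma monomial_notMem_initialIdeal_of_isLeast {L K : Type*} [Lattice L] [Field K]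
    {m : MonomialOrder L} {C : Set (L →₀ ℕ)} (hC : IsStraighteningClosed C) {u : L →₀ ℕ}
    (hu : u ∈ C) (hmin : ∀ v ∈ C, m.toSyn u ≤ m.toSyn v) :
    monomial u (1 : K) ∉ initialIdeal m (joinMeetIdeal K L) := by
  classical
  rw [monomial_mem_initialIdeal_iff]
  rintro ⟨f, hf, hf0, rfl⟩
  have h := coeffSum_eq_zero_of_mem hC hf
  rw [f.as_sum, map_sum, Finset.sum_eq_single_of_mem _ (m.degree_mem_support hf0),
    coeffSum_monomial, if_pos hu] at h
  · exact m.coeff_degree_ne_zero_iff.2 hf0 h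
  · intro v hv hne
    rw [coeffSum_monomial, if_neg]
    intro hvC
    exact hne (m.toSyn.injective (le_antisymm (m.le_degree hv) (hmin v hvC)))

/-! ### Rank classes of an interval -/

open Classical in
/-- The rank function of an interval `[p, q]` of length two; its values outside of the interval
play no role. -/
noncomputable def intervalRank {L : Type*} (p q : L) (x : L) : ℕ :=
  if x = p then 0 else if x = q then 2 else 1

/-- The monomials of degree `n` with variables in the interval `[p, q]`, of total rank `n`, and not
a power of a single variable. If `[p, q]` has length two, this is the congruence class of `p * q`
for `n = 2`, and the union of the classes of `p * q * a` with `p < a < q` for `n = 3`. -/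
def rankClass {L : Type*} [Lattice L] (p q : L) (n : ℕ) : Set (L →₀ ℕ) :=
  {s | (∀ x ∈ s.support, x ∈ Set.Icc p q) ∧ s.degree = n ∧
    Finsupp.weight (intervalRank p q) s = n ∧ ∃ x ∈ s.support, ∃ y ∈ s.support, x ≠ y}

lemma intervalRank_left {L : Type*} (p q : L) : intervalRank p q p = 0 := by
  simp [intervalRank]

lemma intervalRank_right {L : Type*} {p q : L} (h : p ≠ q) : intervalRank p q q = 2 := by
  simp [intervalRank, h.symm]

lemma intervalRank_of_mem_Ioo {L : Type*} [Lattice L] {p q x : L} (h : x ∈ Set.Ioo p q) :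
    intervalRank p q x = 1 := by
  simp [intervalRank, h.1.ne', h.2.ne]

lemma eq_or_eq_or_mem_Ioo {L : Type*} [Lattice L] {p q x : L} (h : x ∈ Set.Icc p q) :
    x = p ∨ x = q ∨ x ∈ Set.Ioo p q := by
  by_cases h1 : x = p
  · exact Or.inl h1
  by_cases h2 : x = q
  · exact Or.inr (Or.inl h2)
  · exact Or.inr (Or.inr ⟨lt_of_le_of_ne h.1 (Ne.symm h1), lt_of_le_of_ne h.2 h2⟩)

lemma mem_Ioo_of_not_le {L : Type*} [Lattice L] {p q a b : L} (ha : a ∈ Set.Icc p q)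
    (hb : b ∈ Set.Icc p q) (hab : ¬ a ≤ b) (hba : ¬ b ≤ a) : a ∈ Set.Ioo p q := by
  rcases eq_or_eq_or_mem_Ioo ha with rfl | rfl | h
  · exact absurd hb.1 hab
  · exact absurd hb.2 hba
  · exact h

lemma mem_support_add_single_add_single {σ : Type*} {w : σ →₀ ℕ} {a b x : σ} :
    x ∈ (w + (Finsupp.single a 1 + Finsupp.single b 1)).support ↔
      x ∈ w.support ∨ x = a ∨ x = b := by
  classical
  simp only [Finsupp.mem_support_iff, Finsupp.add_apply, Finsupp.single_apply]
  split_ifs with h1 h2 h2 <;> simp [*, eq_comm]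

lemma intervalRank_cases {L : Type*} [Lattice L] {p q x : L} (hpq : p ≠ q)
    (h : x ∈ Set.Icc p q) :
    (x = p ∧ intervalRank p q x = 0) ∨ (x = q ∧ intervalRank p q x = 2) ∨
      (x ∈ Set.Ioo p q ∧ intervalRank p q x = 1) := by
  rcases eq_or_eq_or_mem_Ioo h with rfl | rfl | hx
  · exact Or.inl ⟨rfl, intervalRank_left _ _⟩
  · exact Or.inr (Or.inl ⟨rfl, intervalRank_right hpq⟩)
  · exact Or.inr (Or.inr ⟨hx, intervalRank_of_mem_Ioo hx⟩)

lemma isStraighteningClosed_rankClass {L : Type*} [Lattice L] {p q : L}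
    (hpq : ∀ x ∈ Set.Ioo p q, ∀ y ∈ Set.Ioo p q, x ≠ y → x ⊓ y = p ∧ x ⊔ y = q) (n : ℕ) :
    IsStraighteningClosed (rankClass p q n) := by
  intro a b w hab hba
  have hne : a ≠ b := fun e => hab e.le
  have hne' : a ⊓ b ≠ a ⊔ b := fun e => hab (inf_eq_sup.1 e).le
  have hdeg : (w + (Finsupp.single a 1 + Finsupp.single b 1)).degree =
      (w + (Finsupp.single (a ⊓ b) 1 + Finsupp.single (a ⊔ b) 1)).degree := by
    simp [map_add]
  have hwt (ha : a ∈ Set.Icc p q) (hb : b ∈ Set.Icc p q) :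
      Finsupp.weight (intervalRank p q) (w + (Finsupp.single a 1 + Finsupp.single b 1)) =
      Finsupp.weight (intervalRank p q)
        (w + (Finsupp.single (a ⊓ b) 1 + Finsupp.single (a ⊔ b) 1)) := by
    have ha' := mem_Ioo_of_not_le ha hb hab hba
    have hb' := mem_Ioo_of_not_le hb ha hba hab
    obtain ⟨hi, hs⟩ := hpq a ha' b hb' hne
    rw [hi, hs]
    simp only [map_add, Finsupp.weight_single, intervalRank_of_mem_Ioo ha',
      intervalRank_of_mem_Ioo hb', intervalRank_left,
      intervalRank_right (ha'.1.trans ha'.2).ne, smul_eq_mul]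
  constructor
  · rintro ⟨h1, h2, h3, -⟩
    have ha := h1 a (mem_support_add_single_add_single.2 (by simp))
    have hb := h1 b (mem_support_add_single_add_single.2 (by simp))
    refine ⟨fun x hx => ?_, hdeg ▸ h2, hwt ha hb ▸ h3, a ⊓ b,
      mem_support_add_single_add_single.2 (by simp), a ⊔ b,
      mem_support_add_single_add_single.2 (by simp), hne'⟩
    rcases mem_support_add_single_add_single.1 hx with h | rfl | rfl
    · exact h1 x (mem_support_add_single_add_single.2 (Or.inl h))
    · exact ⟨le_inf ha.1 hb.1, inf_le_left.trans ha.2⟩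
    · exact ⟨ha.1.trans le_sup_left, sup_le ha.2 hb.2⟩
  · rintro ⟨h1, h2, h3, -⟩
    have hi := h1 (a ⊓ b) (mem_support_add_single_add_single.2 (by simp))
    have hs := h1 (a ⊔ b) (mem_support_add_single_add_single.2 (by simp))
    have ha : a ∈ Set.Icc p q := ⟨hi.1.trans inf_le_left, le_sup_left.trans hs.2⟩
    have hb : b ∈ Set.Icc p q := ⟨hi.1.trans inf_le_right, le_sup_right.trans hs.2⟩
    refine ⟨fun x hx => ?_, hdeg ▸ h2, (hwt ha hb).trans h3, a,
      mem_support_add_single_add_single.2 (by simp), b,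
      mem_support_add_single_add_single.2 (by simp), hne⟩
    rcases mem_support_add_single_add_single.1 hx with h | rfl | rfl
    · exact h1 x (mem_support_add_single_add_single.2 (Or.inl h))
    · exact ha
    · exact hb

lemma exists_eq_single_add_single_add {σ : Type*} {s : σ →₀ ℕ} {x y : σ} (hx : x ∈ s.support)
    (hy : y ∈ s.support) (hxy : x ≠ y) :
    ∃ w, s = w + (Finsupp.single x 1 + Finsupp.single y 1) := by
  classical
  have hle : Finsupp.single x 1 + Finsupp.single y 1 ≤ s := by
    intro i
    rw [Finsupp.mem_support_iff] at hx hy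
    simp only [Finsupp.add_apply, Finsupp.single_apply]
    split_ifs with h1 h2 h2
    · exact absurd (h1.trans h2.symm) hxy
    · subst h1; omega
    · subst h2; omega
    · omega
  exact ⟨s - (Finsupp.single x 1 + Finsupp.single y 1), (tsub_add_cancel_of_le hle).symm⟩

lemma exists_eq_single_of_degree_eq_one {σ : Type*} {w : σ →₀ ℕ} (h : w.degree = 1) :
    ∃ z, w = Finsupp.single z 1 := by
  have h0 : w ≠ 0 := by rintro rfl; simp at h
  obtain ⟨z, hz⟩ := Finsupp.ne_iff.1 h0
  have hle : Finsupp.single z 1 ≤ w := by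
    rw [Finsupp.single_le_iff]
    exact Nat.one_le_iff_ne_zero.2 hz
  obtain ⟨v, rfl⟩ := exists_add_of_le hle
  rw [map_add, Finsupp.degree_single, Nat.add_eq_left, Finsupp.degree_eq_zero_iff] at h
  exact ⟨z, by rw [h, add_zero]⟩

/-- The quadratic class consists of `p * q` and the products of two complements in `[p, q]`. -/
lemma eq_of_mem_rankClass_two {L : Type*} [Lattice L] {p q : L} (hpq : p ≠ q) {s : L →₀ ℕ}
    (hs : s ∈ rankClass p q 2) :
    s = Finsupp.single p 1 + Finsupp.single q 1 ∨
      ∃ x ∈ Set.Ioo p q, ∃ y ∈ Set.Ioo p q, x ≠ y ∧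
        s = Finsupp.single x 1 + Finsupp.single y 1 := by
  obtain ⟨h1, h2, h3, x, hx, y, hy, hxy⟩ := hs
  have hx' := h1 x hx
  have hy' := h1 y hy
  obtain ⟨w, rfl⟩ := exists_eq_single_add_single_add hx hy hxy
  have hw : w = 0 := by
    rw [← Finsupp.degree_eq_zero_iff]
    simp only [map_add, Finsupp.degree_single] at h2
    omega
  subst hw
  simp only [map_add, Finsupp.weight_single, smul_eq_mul, one_mul, zero_add] at h3
  rw [zero_add]
  rcases intervalRank_cases hpq hx' with ⟨ex, rx⟩ | ⟨ex, rx⟩ | ⟨hxm, rx⟩ <;>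
    rcases intervalRank_cases hpq hy' with ⟨ey, ry⟩ | ⟨ey, ry⟩ | ⟨hym, ry⟩ <;>
    first | omega | skip
  · exact Or.inl (by rw [ex, ey])
  · exact Or.inl (by rw [ex, ey, add_comm])
  · exact Or.inr ⟨x, hxm, y, hym, hxy, rfl⟩

/-- A cubic monomial of rank three is a product of an element strictly between `p` and `q` with a
monomial of the quadratic class. -/
lemma exists_of_mem_rankClass_three {L : Type*} [Lattice L] {p q : L} (hpq : p ≠ q) {s : L →₀ ℕ}
    (hs : s ∈ rankClass p q 3) :
    ∃ z ∈ Set.Ioo p q, ∃ t, s = Finsupp.single z 1 + t ∧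
      (t = Finsupp.single p 1 + Finsupp.single q 1 ∨
      ∃ x ∈ Set.Ioo p q, ∃ y ∈ Set.Ioo p q, x ≠ y ∧
        t = Finsupp.single x 1 + Finsupp.single y 1) := by
  obtain ⟨h1, h2, h3, x, hx, y, hy, hxy⟩ := hs
  have hx' := h1 x hx
  have hy' := h1 y hy
  obtain ⟨w, rfl⟩ := exists_eq_single_add_single_add hx hy hxy
  obtain ⟨z, rfl⟩ : ∃ z, w = Finsupp.single z 1 := by
    apply exists_eq_single_of_degree_eq_one
    simp only [map_add, Finsupp.degree_single] at h2
    omega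
  have hz' := h1 z (mem_support_add_single_add_single.2 (Or.inl (by simp)))
  simp only [map_add, Finsupp.weight_single, smul_eq_mul, one_mul] at h3
  rcases intervalRank_cases hpq hx' with ⟨ex, rx⟩ | ⟨ex, rx⟩ | ⟨hxm, rx⟩ <;>
    rcases intervalRank_cases hpq hy' with ⟨ey, ry⟩ | ⟨ey, ry⟩ | ⟨hym, ry⟩ <;>
    rcases intervalRank_cases hpq hz' with ⟨ez, rz⟩ | ⟨ez, rz⟩ | ⟨hzm, rz⟩ <;>
    first | omega | skip
  · exact ⟨z, hzm, _, rfl, Or.inl (by rw [ex, ey])⟩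
  · exact ⟨y, hym, _, by rw [ex, ez]; abel, Or.inl rfl⟩
  · exact ⟨z, hzm, _, rfl, Or.inl (by rw [ex, ey, add_comm])⟩
  · exact ⟨y, hym, _, by rw [ex, ez]; abel, Or.inl rfl⟩
  · exact ⟨x, hxm, _, by rw [ey, ez]; abel, Or.inl rfl⟩
  · exact ⟨x, hxm, _, by rw [ey, ez]; abel, Or.inl rfl⟩
  · exact ⟨z, hzm, _, rfl, Or.inr ⟨x, hxm, y, hym, hxy, rfl⟩⟩

lemma single_add_single_mem_rankClass {L : Type*} [Lattice L] {p q : L} (hpq : p < q) :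
    Finsupp.single p 1 + Finsupp.single q 1 ∈ rankClass p q 2 := by
  have hs (x : L) : x ∈ (Finsupp.single p 1 + Finsupp.single q 1 : L →₀ ℕ).support ↔
      x = p ∨ x = q := by
    simpa using mem_support_add_single_add_single (w := 0) (a := p) (b := q) (x := x)
  refine ⟨fun x hx => ?_, by simp [map_add], ?_, p, (hs p).2 (Or.inl rfl), q,
    (hs q).2 (Or.inr rfl), hpq.ne⟩
  · rcases (hs x).1 hx with rfl | rfl
    · exact ⟨le_rfl, hpq.le⟩
    · exact ⟨hpq.le, le_rfl⟩
  · simp [map_add, Finsupp.weight_single, intervalRank_left, intervalRank_right hpq.ne]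

lemma single_add_single_add_single_mem_rankClass {L : Type*} [Lattice L] {p q a : L}
    (ha : a ∈ Set.Ioo p q) :
    Finsupp.single a 1 + (Finsupp.single p 1 + Finsupp.single q 1) ∈ rankClass p q 3 := by
  have hpq := ha.1.trans ha.2
  refine ⟨fun x hx => ?_, by simp [map_add], ?_, p,
    mem_support_add_single_add_single.2 (by simp), q,
    mem_support_add_single_add_single.2 (by simp), hpq.ne⟩
  · rcases mem_support_add_single_add_single.1 hx with h | rfl | rfl
    · obtain rfl : x = a := by simpa using h
      exact ⟨ha.1.le, ha.2.le⟩
    · exact ⟨le_rfl, hpq.le⟩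
    · exact ⟨hpq.le, le_rfl⟩
  · simp [map_add, Finsupp.weight_single, intervalRank_left, intervalRank_right hpq.ne,
      intervalRank_of_mem_Ioo ha]

lemma exists_isLeast_toSyn {σ : Type*} (m : MonomialOrder σ) {C : Set (σ →₀ ℕ)}
    (hC : C.Nonempty) : ∃ u ∈ C, ∀ v ∈ C, m.toSyn u ≤ m.toSyn v := by
  obtain ⟨u, hu, hmin⟩ :=
    (InvImage.wf m.toSyn (wellFounded_lt (α := m.syn))).has_min C hC
  exact ⟨u, hu, fun v hv => not_lt.1 (hmin v hv)⟩

/-! ### Binomials coming from three complements -/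

lemma X_mul_X_sub_mem_joinMeetIdeal (K : Type*) [Field K] {L : Type*} [Lattice L] {p q x y : L}
    (hpq : ∀ x ∈ Set.Ioo p q, ∀ y ∈ Set.Ioo p q, x ≠ y → x ⊓ y = p ∧ x ⊔ y = q)
    (hx : x ∈ Set.Ioo p q) (hy : y ∈ Set.Ioo p q) (hxy : x ≠ y) :
    (X x * X y - X p * X q : MvPolynomial L K) ∈ joinMeetIdeal K L := by
  obtain ⟨hi, hs⟩ := hpq x hx y hy hxy
  refine Ideal.subset_span ⟨x, y, fun h => ?_, fun h => ?_, by rw [hi, hs]⟩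
  · exact hx.1.ne' ((inf_eq_left.2 h).symm.trans hi)
  · exact hy.1.ne' ((inf_eq_right.2 h).symm.trans hi)

section

variable {R : Type*} [CommRing R] {I : Ideal R} {a b c t : R}

/-- If `ab` and `ac` are congruent to `t`, then `tb` and `tc` are congruent to `abc`. -/
lemma Ideal.mul_sub_mul_mem_of_three (hab : a * b - t ∈ I) (hac : a * c - t ∈ I) :
    t * b - t * c ∈ I := by
  have h := I.sub_mem (I.mul_mem_left c hab) (I.mul_mem_left b hac)
  convert h using 1
  ring

lemma Ideal.sq_mul_sub_mul_sq_mem_of_three (hab : a * b - t ∈ I) (hac : a * c - t ∈ I)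
    (hbc : b * c - t ∈ I) : b * b * c - b * c * c ∈ I := by
  have h := I.add_mem (I.mul_mem_left (b - c) hbc) (I.mul_sub_mul_mem_of_three hab hac)
  convert h using 1
  ring

lemma Ideal.mul_sq_sub_sq_mem_of_three (hab : a * b - t ∈ I) (hac : a * c - t ∈ I)
    (hbc : b * c - t ∈ I) : c * c * t - t * t ∈ I := by
  have h := I.sub_mem (I.mul_mem_left t hbc)
    (I.mul_mem_left c (I.mul_sub_mul_mem_of_three hab hac))
  convert h using 1
  ring

end

/-- Among the two sides of a binomial in `I`, the larger one is an initial monomial. -/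
lemma monomial_mem_initialIdeal_or {σ K : Type*} [Field K] {m : MonomialOrder σ}
    {I : Ideal (MvPolynomial σ K)} {u v : σ →₀ ℕ} (huv : u ≠ v)
    (h : monomial u (1 : K) - monomial v 1 ∈ I) :
    monomial u (1 : K) ∈ initialIdeal m I ∨ monomial v (1 : K) ∈ initialIdeal m I := by
  rcases lt_or_gt_of_ne (m.toSyn.injective.ne huv) with h' | h'
  · refine Or.inr (monomial_mem_initialIdeal_of_sub_mem h' ?_)
    rw [← neg_sub]
    exact I.neg_mem h
  · exact Or.inl (monomial_mem_initialIdeal_of_sub_mem h' h)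

/-! ### The initial ideal is not squarefree -/

theorem theorem1p3 (K : Type*) [Field K] (L : Type*) [Lattice L] [Finite L] [IsModularLattice L]
    (hL : ¬ IsDistributiveLattice L) (m : MonomialOrder L) :
    ¬ IsSquarefreeMonomialIdeal (initialIdeal m (joinMeetIdeal K L)) := by
  classical
  intro hJ
  obtain ⟨p, q, hpq, a, ha, b, hb, c, hc, hab, hac, hbc⟩ := exists_interval_three_complements hL
  have hlt : p < q := ha.1.trans ha.2
  -- Any two elements strictly inside the interval have a third one beside them.
  have third : ∀ x y, ∃ z ∈ Set.Ioo p q, z ≠ x ∧ z ≠ y := by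
    intro x y
    by_contra! hno
    have h1 := hno a ha
    have h2 := hno b hb
    have h3 := hno c hc
    by_cases hax : a = x
    · subst hax
      exact hbc ((h2 hab.symm).trans (h3 hac.symm).symm)
    · have hay := h1 hax
      subst hay
      by_cases hbx : b = x
      · subst hbx
        exact hac (h3 hbc.symm).symm
      · exact hab (h2 hbx).symm
  have hgen := fun {x y : L} => X_mul_X_sub_mem_joinMeetIdeal K (x := x) (y := y) hpq
  obtain ⟨u, hu, hmin⟩ := exists_isLeast_toSyn m ⟨_, single_add_single_mem_rankClass hlt⟩
  have hnot := monomial_notMem_initialIdeal_of_isLeast (K := K)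
    (isStraighteningClosed_rankClass hpq 2) hu hmin
  rcases eq_of_mem_rankClass_two hlt.ne hu with rfl | ⟨x, hx, y, hy, hxy, rfl⟩
  · obtain ⟨v, hv, hvmin⟩ :=
      exists_isLeast_toSyn m ⟨_, single_add_single_add_single_mem_rankClass ha⟩
    obtain ⟨z, hz, t, rfl, ht⟩ := exists_of_mem_rankClass_three hlt.ne hv
    -- Replacing `t` by `p * q`, smallest in its class, keeps the cubic monomial smallest.
    have hle : m.toSyn (Finsupp.single p 1 + Finsupp.single q 1) ≤ m.toSyn t := by
      rcases ht with rfl | ⟨x, hx, y, hy, hxy, rfl⟩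
      · exact le_rfl
      · apply hmin
        have := (isStraighteningClosed_rankClass hpq 2 x y 0
          (fun h => hx.1.ne' ((inf_eq_left.2 h).symm.trans (hpq x hx y hy hxy).1))
          (fun h => hy.1.ne' ((inf_eq_right.2 h).symm.trans (hpq x hx y hy hxy).1))).2
        rw [(hpq x hx y hy hxy).1, (hpq x hx y hy hxy).2, zero_add, zero_add] at this
        exact this hu
    have hnot' := monomial_notMem_initialIdeal_of_isLeast (K := K) (m := m)
      (isStraighteningClosed_rankClass hpq 3)
      (single_add_single_add_single_mem_rankClass hz) (fun w hw => by
        refine le_trans ?_ (hvmin w hw)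
        rw [map_add, map_add m.toSyn _ t]
        exact add_le_add_right hle _)
    obtain ⟨y, hy, hyz, -⟩ := third z z
    obtain ⟨x, hx, hxy, hxz⟩ := third y z
    have hmem := Ideal.mul_sq_sub_sq_mem_of_three (hgen hx hy hxy) (hgen hx hz hxz)
      (hgen hy hz hyz)
    have hbin : monomial (Finsupp.single z 1 + Finsupp.single z 1 +
          (Finsupp.single p 1 + Finsupp.single q 1)) (1 : K) -
        monomial (Finsupp.single p 1 + Finsupp.single q 1 +
          (Finsupp.single p 1 + Finsupp.single q 1)) 1 ∈ joinMeetIdeal K L := by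
      simpa [X, monomial_mul] using hmem
    rcases monomial_mem_initialIdeal_or (m := m) (fun e => by
      have := DFunLike.congr_fun e z
      simp [hz.1.ne, hz.2.ne'] at this) hbin with h | h
    · refine hnot' (hJ.monomial_mem h fun i hi => ?_)
      simp only [Finsupp.mem_support_iff, Finsupp.add_apply] at hi ⊢
      omega
    · refine hnot (hJ.monomial_mem h fun i hi => ?_)
      simp only [Finsupp.mem_support_iff, Finsupp.add_apply] at hi ⊢
      omega
  · obtain ⟨z, hz, hzx, hzy⟩ := third x y
    have hmem := Ideal.sq_mul_sub_mul_sq_mem_of_three (hgen hz hx hzx) (hgen hz hy hzy)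
      (hgen hx hy hxy)
    have hbin : monomial (Finsupp.single x 1 + Finsupp.single x 1 + Finsupp.single y 1) (1 : K) -
        monomial (Finsupp.single x 1 + Finsupp.single y 1 + Finsupp.single y 1) 1 ∈
          joinMeetIdeal K L := by
      simpa [X, monomial_mul] using hmem
    -- Both monomials have the variables `x` and `y` only.
    rcases monomial_mem_initialIdeal_or (m := m) (fun e => by
      have := DFunLike.congr_fun e x
      simp [hxy.symm] at this) hbin with h | h <;>
    · refine hnot (hJ.monomial_mem h fun i hi => ?_)
      simp only [Finsupp.mem_support_iff, Finsupp.add_apply] at hi ⊢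
      omega
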